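/- Let $X$ be a separable real Banach space that is (isometrically) the dual of a Banach space $X_*$, let $S\subset\mathbb R^d$ be non-empty and compact, and let $J\colon X\times S\to[0,+\infty]$ be Borel measurable and such that (H1) for every $s\in S$ the function $J(\cdot,s)$ is proper, convex and positively one-homogeneous, i.e. $J(\lambda v,s)=\lambda J(v,s)$ for all $\lambda\ge 0$, $v\in X$ (with $0\cdot\infty=0$); (H2) $J$ is sequentially lower semicontinuous on $X\times S$, where $X$ carries the weak* topology induced by $X_*$; (H3) there is a constant $C_0>0$ with $\|v\|_X\le C_0\,J(v,s)$ for all $v\in X$, $s\in S$. Let $\mathcal M(S;X)$ be the vector space of countably additive $X$-valued Borel measures $\mu$ on $S$ of finite variation, that is, with $|\mu|(S)<\infty$, where $|\mu|(E)=\sup\{\sum_{i=1}^n\|\mu(A_i)\|_X : n\in\mathbb N,\ (A_i)_{i=1}^n \text{ a Borel partition of } E\}$, and put $\|\mu\|_{\mathcal M}=|\mu|(S)$. Then every $\mu\in\mathcal M(S;X)$ has a density $\frac{\mu}{|\mu|}\in L^1((S,|\mu|);X)$, i.e. $\mu(E)=\int_E\frac{\mu}{|\mu|}\,d|\mu|$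 (Bochner integral) for all Borel $E\subset S$; it is unique $|\mu|$-a.e., and the functional $$\hat F\colon\mathcal M(S;X)\to[0,+\infty],\qquad \hat F(\mu)=\int_S J\Big(\frac{\mu}{|\mu|}(s),s\Big)\,d|\mu|(s),$$ has the following properties: 1. $\hat F$ is convex; 2. $\hat F$ is positively one-homogeneous: $\hat F(\lambda\mu)=\lambda\hat F(\mu)$ for all $\lambda\ge0$ and $\mu\in\mathcal M(S;X)$ (with $0\cdot\infty=0$); 3. $\hat F$ is coercive: there exists $C>0$ such that $\hat F(\mu)\ge C\|\mu\|_{\mathcal M}$ for all $\mu\in\mathcal M(S;X)$; 4. if $\mu,\nu\in\mathcal M(S;X)$ are such that $|\mu|$ and $|\nu|$ are mutually singular, then $\hat F(\mu+\nu)=\hat F(\mu)+\hat F(\nu)$. -/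

import Mathlib

open MeasureTheory Filter Topology
open scoped ENNReal NNReal

noncomputable section

/-- `𝓜(S; X)`: the vector space of countably additive `X`-valued measures on `S` with finite
(total) variation, where the variation is the supremum of `∑ i, ‖μ (A i)‖` over finite measurable
partitions. -/
def radonMeasures (S X : Type*) [MeasurableSpace S] [NormedAddCommGroup X] [NormedSpace ℝ X] :
    Submodule ℝ (VectorMeasure S X) where
  carrier := {μ | μ.variation Set.univ < ∞}
  zero_mem' := by simp
  add_mem' := by
    intro μ ν hμ hν
    exact (VectorMeasure.variation_add_le (μ := μ) (ν := ν) Set.univ).trans_lt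
      (ENNReal.add_lt_top.2 ⟨hμ, hν⟩)
  smul_mem' := by
    intro c μ hμ
    have h : (c • μ).variation Set.univ = (‖c‖₊ : ℝ≥0∞) * μ.variation Set.univ := by
      rw [VectorMeasure.variation_smul]
      rfl
    exact h.trans_lt (ENNReal.mul_lt_top ENNReal.coe_lt_top hμ)

section

variable {S X : Type*} [MeasurableSpace S] [NormedAddCommGroup X] [NormedSpace ℝ X]

/-- The variation measure `|μ|`. -/
def totalVar (μ : radonMeasures S X) : Measure S := (μ : VectorMeasure S X).variation

instance (μ : radonMeasures S X) : IsFiniteMeasure (totalVar μ) := ⟨μ.2⟩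

/-- The total variation norm `‖μ‖ = |μ|(S)`. -/
def tvNorm (μ : radonMeasures S X) : ℝ := (totalVar μ).real Set.univ

/-- `u` is a density `μ / |μ|`: it is Bochner integrable with respect to `|μ|` and
`μ E = ∫_E u d|μ|` for every measurable `E`. -/
def IsDensity (μ : radonMeasures S X) (u : S → X) : Prop :=
  Integrable u (totalVar μ) ∧
    ∀ E : Set S, MeasurableSet E → (μ : VectorMeasure S X) E = ∫ s in E, u s ∂(totalVar μ)

open Classical in
/-- The density `μ / |μ|`, unique up to `|μ|`-null sets (see `IsDensity.ae_eq`); the value is the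
junk function `0` if there is no density. -/
def density (μ : radonMeasures S X) : S → X :=
  if h : ∃ u, IsDensity μ u then h.choose else 0

/-- The lifted functional `μ ↦ ∫ J ((μ / |μ|) s, s) d|μ|`. -/
def liftedFunctional (J : X → S → ℝ≥0∞) (μ : radonMeasures S X) : ℝ≥0∞ :=
  ∫⁻ s, J (density μ s) s ∂(totalVar μ)

theorem isDensity_density {μ : radonMeasures S X} (h : ∃ u, IsDensity μ u) :
    IsDensity μ (density μ) := by
  rw [density, dif_pos h]
  exact h.choose_spec

theorem IsDensity.ae_eq [CompleteSpace X] {μ : radonMeasures S X} {u v : S → X}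
    (hu : IsDensity μ u) (hv : IsDensity μ v) : u =ᵐ[totalVar μ] v :=
  Integrable.ae_eq_of_forall_setIntegral_eq u v hu.1 hv.1
    fun E hE _ => (hu.2 E hE).symm.trans (hv.2 E hE)

/-- The lifted functional can be computed with any density. -/
theorem liftedFunctional_eq [CompleteSpace X] (J : X → S → ℝ≥0∞) {μ : radonMeasures S X}
    {u : S → X} (hu : IsDensity μ u) :
    liftedFunctional J μ = ∫⁻ s, J (u s) s ∂(totalVar μ) := by
  refine lintegral_congr_ae ?_
  filter_upwards [(isDensity_density ⟨u, hu⟩).ae_eq hu] with s hs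
  rw [hs]

end

end

/-!
A separable dual space has the Radon–Nikodym property (Dunford–Pettis): if `‖μ A‖ ≤ C m(A)`, every
scalar measure `A ↦ μ A p` has a density `g p` with respect to `m` with `|g p| ≤ C ‖p‖`. The predual
is separable too, so the `g p` can be compared along a countable dense subgroup of `p`'s at once:
off a single null set `p ↦ g p s` is additive and bounded there, hence extends to a functional
`u s`, and `u` is the density of `μ`.

By homogeneity of `J`, `∫ J (f s, s) dm` is the same for all representations `μ = f m`. Representing
two measures by densities with respect to a common `m` turns the properties of the lifted functional
into pointwise properties of `J`; for mutually singular measures the two densities have essentially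
disjoint supports.
-/

theorem dense_span_of_forall_strongDual_eq_zero {P : Type*} [AddCommGroup P] [Module ℝ P]
    [TopologicalSpace P] [IsTopologicalAddGroup P] [ContinuousSMul ℝ P] [LocallyConvexSpace ℝ P]
    {s : Set P} (hs : ∀ f : StrongDual ℝ P, (∀ p ∈ s, f p = 0) → f = 0) :
    Dense (Submodule.span ℝ s : Set P) := by
  by_contra hdense
  obtain ⟨q, hq⟩ : ∃ q, q ∉ (Submodule.span ℝ s).topologicalClosure :=
    not_forall.1 hdense
  obtain ⟨f, c, hf, hfq⟩ := geometric_hahn_banach_closed_point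
    (Submodule.convex (Submodule.span ℝ s).topologicalClosure)
    (Submodule.isClosed_topologicalClosure _) hq
  have hc : 0 < c := by simpa using hf 0 (Submodule.zero_mem _)
  -- A linear functional bounded above on a subspace vanishes there.
  have hfs : ∀ p ∈ s, f p = 0 := by
    intro p hp
    by_contra hne
    have hlt := hf ((c / f p) • p) (Submodule.smul_mem _ _
      (Submodule.le_topologicalClosure _ (Submodule.subset_span hp)))
    rw [map_smul, smul_eq_mul, div_mul_cancel₀ _ hne] at hlt
    exact hlt.false
  rw [hs f hfs, zero_apply] at hfq
  exact hc.not_gt hfq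

section SeparableDual

variable {P : Type*} [NormedAddCommGroup P] [NormedSpace ℝ P]

theorem exists_norm_le_one_half_norm_le_norm_apply (f : StrongDual ℝ P) :
    ∃ p : P, ‖p‖ ≤ 1 ∧ ‖f‖ / 2 ≤ ‖f p‖ := by
  rcases eq_or_ne f 0 with rfl | hf
  · exact ⟨0, by simp, by simp⟩
  · obtain ⟨p, hp, hlt⟩ := f.exists_lt_apply_of_lt_opNorm (half_lt_self (norm_pos_iff.2 hf))
    exact ⟨p, hp.le, hlt.le⟩

theorem eq_zero_of_forall_apply_norming_eq_zero {ι : Type*} {x : ι → StrongDual ℝ P}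
    (hx : DenseRange x) {p : ι → P} (hp : ∀ i, ‖p i‖ ≤ 1) (hxp : ∀ i, ‖x i‖ / 2 ≤ ‖x i (p i)‖)
    {f : StrongDual ℝ P} (hf : ∀ i, f (p i) = 0) : f = 0 := by
  have hnorm : ∀ i, ‖f‖ ≤ 3 * ‖f - x i‖ := by
    intro i
    have hxi : ‖x i (p i)‖ ≤ ‖f - x i‖ := by
      simpa [hf i] using (f - x i).le_of_opNorm_le_of_le le_rfl (hp i)
    have htri : ‖f‖ ≤ ‖f - x i‖ + ‖x i‖ := by simpa using norm_add_le (f - x i) (x i)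
    linarith [hxp i]
  have hle : ‖f‖ ≤ 3 * ‖f - f‖ :=
    hx.induction_on (p := fun g => ‖f‖ ≤ 3 * ‖f - g‖) f
      (isClosed_le (by fun_prop) (by fun_prop)) hnorm
  simpa using hle

theorem separableSpace_of_separableSpace_strongDual
    [TopologicalSpace.SeparableSpace (StrongDual ℝ P)] : TopologicalSpace.SeparableSpace P := by
  choose p hp hxp using fun n => exists_norm_le_one_half_norm_le_norm_apply
    (TopologicalSpace.denseSeq (StrongDual ℝ P) n)
  have hdense : Dense (Submodule.span ℝ (Set.range p) : Set P) :=
    dense_span_of_forall_strongDual_eq_zero fun f hf =>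
      eq_zero_of_forall_apply_norming_eq_zero (TopologicalSpace.denseRange_denseSeq _) hp hxp
        fun n => hf _ ⟨n, rfl⟩
  rw [← TopologicalSpace.isSeparable_univ_iff, ← hdense.closure_eq]
  exact (Set.countable_range p).isSeparable.span.closure

end SeparableDual

theorem exists_countable_dense_addSubgroup (P : Type*) [AddCommGroup P] [TopologicalSpace P]
    [TopologicalSpace.SeparableSpace P] : ∃ D : AddSubgroup P, Countable D ∧ Dense (D : Set P) :=
  ⟨(Submodule.span ℤ (Set.range (TopologicalSpace.denseSeq P))).toAddSubgroup,
    inferInstanceAs (Countable (Submodule.span ℤ (Set.range (TopologicalSpace.denseSeq P)))),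
    (TopologicalSpace.denseRange_denseSeq P).mono Submodule.subset_span⟩

theorem exists_continuousLinearMap_extend_addMonoidHom {P F : Type*} [NormedAddCommGroup P]
    [NormedSpace ℝ P] [NormedAddCommGroup F] [NormedSpace ℝ F] [CompleteSpace F]
    {D : AddSubgroup P} (hD : Dense (D : Set P)) (g : D →+ F) {C : ℝ} (hC : 0 ≤ C)
    (hg : ∀ p : D, ‖g p‖ ≤ C * ‖(p : P)‖) :
    ∃ f : P →L[ℝ] F, ‖f‖ ≤ C ∧ ∀ p : D, f p = g p := by
  let gZ : D →L[ℤ] F := ⟨g.toIntLinearMap, AddMonoidHomClass.continuous_of_bound g C hg⟩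
  let incl : D →L[ℤ] P := ⟨D.subtype.toIntLinearMap, continuous_subtype_val⟩
  have hext : ∀ p : D, gZ.extend incl p = g p := fun p =>
    gZ.extend_eq hD.denseRange_val isUniformEmbedding_subtype_val.isUniformInducing p
  let f : P →L[ℝ] F :=
    AddMonoidHom.toRealLinearMap (gZ.extend incl : P →+ F) (gZ.extend incl).continuous
  refine ⟨f, f.opNorm_le_bound hC fun p => ?_, hext⟩
  refine hD.induction (P := fun p => ‖f p‖ ≤ C * ‖p‖) (fun p hp => ?_)
    (isClosed_le (by fun_prop) (by fun_prop)) p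
  exact (congrArg norm (hext ⟨p, hp⟩)).trans_le (hg ⟨p, hp⟩)

section Selection

variable {P S : Type*} [NormedAddCommGroup P] [NormedSpace ℝ P]
  [TopologicalSpace.SeparableSpace (StrongDual ℝ P)]

theorem measurableEmbedding_apply_of_dense [MeasurableSpace (StrongDual ℝ P)]
    [BorelSpace (StrongDual ℝ P)] {D : Set P} [Countable D] (hD : Dense D) :
    MeasurableEmbedding fun (f : StrongDual ℝ P) (p : D) => f p :=
  (measurable_pi_lambda _ fun p : D =>
    (ContinuousLinearMap.apply ℝ ℝ (p : P)).continuous.measurable).measurableEmbedding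
      fun _ _ hfg => ContinuousLinearMap.ext_on (hD.mono Submodule.subset_span)
        fun p hp => congrFun hfg ⟨p, hp⟩

variable [MeasurableSpace S] {m : Measure S}

theorem exists_aestronglyMeasurable_strongDual_of_ae_add {D : AddSubgroup P} [Countable D]
    (hD : Dense (D : Set P)) {g : D → S → ℝ} (hgm : ∀ p, AEMeasurable (g p) m)
    (hadd : ∀ p q, g (p + q) =ᵐ[m] g p + g q) {C : ℝ} (hC : 0 ≤ C)
    (hle : ∀ p, ∀ᵐ s ∂m, ‖g p s‖ ≤ C * ‖(p : P)‖) :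
    ∃ u : S → StrongDual ℝ P, AEStronglyMeasurable u m ∧ (∀ᵐ s ∂m, ‖u s‖ ≤ C) ∧
      ∀ p : D, ∀ᵐ s ∂m, u s p = g p s := by
  have hext : ∀ᵐ s ∂m, ∃ f : StrongDual ℝ P, ‖f‖ ≤ C ∧ ∀ p : D, f p = g p s := by
    filter_upwards [ae_all_iff.2 fun p => ae_all_iff.2 (hadd p), ae_all_iff.2 hle]
      with s hs_add hs_le
    exact exists_continuousLinearMap_extend_addMonoidHom hD
      (AddMonoidHom.mk' (fun p => g p s) hs_add) hC hs_le
  obtain ⟨u, hu⟩ := skolem.1 hext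
  borelize (StrongDual ℝ P)
  have hum : AEMeasurable u m := by
    refine (measurableEmbedding_apply_of_dense hD).aemeasurable_comp_iff.1
      ((aemeasurable_pi_iff.2 hgm).congr ?_)
    filter_upwards [hu] with s hs using funext fun p => (hs.2 p).symm
  exact ⟨u, hum.aestronglyMeasurable, hu.mono fun s hs => hs.1, fun p => hu.mono fun s hs => hs.2 p⟩

end Selection

section RadonNikodym

variable {S : Type*} [MeasurableSpace S] {m : Measure S}

section ImageMeasure

variable {E F : Type*} [NormedAddCommGroup E] [NormedSpace ℝ E] [NormedAddCommGroup F]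
  [NormedSpace ℝ F]

/-- The image `L ∘ μ` of a vector measure under a continuous linear map: `VectorMeasure.mapRange`
with the map bundled as `E →L[ℝ] F`. -/
noncomputable def imageMeasure (L : E →L[ℝ] F) (μ : VectorMeasure S E) : VectorMeasure S F :=
  μ.mapRange (L : E →+ F) L.continuous

theorem imageMeasure_apply (L : E →L[ℝ] F) (μ : VectorMeasure S E) (A : Set S) :
    imageMeasure L μ A = L (μ A) := rfl

theorem withDensityᵥ_continuousLinearMap_comp [CompleteSpace E] [CompleteSpace F] (L : E →L[ℝ] F)
    {f : S → E} (hf : Integrable f m) :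
    m.withDensityᵥ (fun s => L (f s)) = imageMeasure L (m.withDensityᵥ f) := by
  ext A hA
  rw [withDensityᵥ_apply (L.integrable_comp hf) hA, imageMeasure_apply, withDensityᵥ_apply hf hA]
  exact L.integral_comp_comm hf.integrableOn

end ImageMeasure

theorem ae_enorm_le_of_forall_enorm_withDensityᵥ_le {E : Type*} [NormedAddCommGroup E]
    [NormedSpace ℝ E] [CompleteSpace E] [SigmaFinite m] {f : S → E} (hf : Integrable f m)
    {C : ℝ≥0∞} (h : ∀ A, MeasurableSet A → ‖m.withDensityᵥ f A‖ₑ ≤ C * m A) :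
    ∀ᵐ s ∂m, ‖f s‖ₑ ≤ C := by
  have hvar : m.withDensity (fun s => ‖f s‖ₑ) ≤ C • m := by
    rw [← Measure.variation_withDensityᵥ hf]
    exact VectorMeasure.variation_le_of_forall_enorm_le h
  refine ae_le_of_forall_setLIntegral_le_of_sigmaFinite₀ hf.1.enorm fun A hA _ => ?_
  rw [← withDensity_apply _ hA, setLIntegral_const]
  exact hvar A

theorem withDensityᵥ_rnDeriv_of_forall_enorm_le [SigmaFinite m] {ν : SignedMeasure S} {C : ℝ≥0∞}
    (h : ∀ A, MeasurableSet A → ‖ν A‖ₑ ≤ C * m A) : m.withDensityᵥ (ν.rnDeriv m) = ν := by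
  refine SignedMeasure.withDensityᵥ_rnDeriv_eq ν m
    (VectorMeasure.AbsolutelyContinuous.mk fun A hA hmA => ?_)
  rw [Measure.toENNRealVectorMeasure_apply_measurable hA] at hmA
  simpa [hmA] using h A hA

variable {P : Type*} [NormedAddCommGroup P] [NormedSpace ℝ P]

/-- For a measure `μ` with values in a dual space, the scalar measure `A ↦ μ A p`. -/
noncomputable def evalMeasure (μ : VectorMeasure S (StrongDual ℝ P)) (p : P) : SignedMeasure S :=
  imageMeasure (ContinuousLinearMap.apply ℝ ℝ p) μ

theorem ext_evalMeasure_of_dense {D : Set P} (hD : Dense D) {μ ν : VectorMeasure S (StrongDual ℝ P)}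
    (h : ∀ p ∈ D, evalMeasure μ p = evalMeasure ν p) : μ = ν := by
  ext1 A -
  exact ContinuousLinearMap.ext_on (hD.mono Submodule.subset_span)
    fun p hp => congrArg (fun κ : SignedMeasure S => κ A) (h p hp)

theorem enorm_evalMeasure_le {μ : VectorMeasure S (StrongDual ℝ P)} {C : ℝ≥0∞} {A : Set S}
    (h : ‖μ A‖ₑ ≤ C * m A) (p : P) : ‖evalMeasure μ p A‖ₑ ≤ C * ‖p‖ₑ * m A := by
  calc ‖μ A p‖ₑ ≤ ‖μ A‖ₑ * ‖p‖ₑ := (μ A).le_opENorm p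
    _ ≤ C * m A * ‖p‖ₑ := by gcongr
    _ = C * ‖p‖ₑ * m A := by ring

/-- Dunford–Pettis -/
theorem exists_withDensityᵥ_eq_of_forall_enorm_le_strongDual
    [TopologicalSpace.SeparableSpace (StrongDual ℝ P)] [IsFiniteMeasure m]
    {μ : VectorMeasure S (StrongDual ℝ P)} {C : ℝ≥0}
    (h : ∀ A, MeasurableSet A → ‖μ A‖ₑ ≤ C * m A) :
    ∃ u : S → StrongDual ℝ P, Integrable u m ∧ m.withDensityᵥ u = μ := by
  have : TopologicalSpace.SeparableSpace P := separableSpace_of_separableSpace_strongDual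
  obtain ⟨D, _, hD⟩ := exists_countable_dense_addSubgroup P
  let g (p : D) : S → ℝ := (evalMeasure μ p).rnDeriv m
  have hg (p : D) : m.withDensityᵥ (g p) = evalMeasure μ p :=
    withDensityᵥ_rnDeriv_of_forall_enorm_le fun A hA => enorm_evalMeasure_le (h A hA) p
  have hgi (p : D) : Integrable (g p) m := SignedMeasure.integrable_rnDeriv _ _
  have hadd (p q : D) : g (p + q) =ᵐ[m] g p + g q := by
    refine (hgi _).ae_eq_of_withDensityᵥ_eq ((hgi p).add (hgi q)) ?_
    rw [withDensityᵥ_add (hgi p) (hgi q), hg, hg, hg]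
    ext A -
    exact map_add (μ A) (p : P) q
  have hle (p : D) : ∀ᵐ s ∂m, ‖g p s‖ ≤ C * ‖(p : P)‖ := by
    have hbound := ae_enorm_le_of_forall_enorm_withDensityᵥ_le (C := C * ‖(p : P)‖ₑ) (hgi p)
      fun A hA => by rw [hg]; exact enorm_evalMeasure_le (h A hA) p
    filter_upwards [hbound] with s hs
    simp only [enorm_eq_nnnorm] at hs
    exact_mod_cast hs
  obtain ⟨u, hum, huC, hug⟩ := exists_aestronglyMeasurable_strongDual_of_ae_add hD
    (fun p => (hgi p).1.aemeasurable) hadd C.2 hle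
  have hui : Integrable u m := .of_bound hum C huC
  refine ⟨u, hui, ext_evalMeasure_of_dense hD fun p hp => ?_⟩
  rw [← hg ⟨p, hp⟩]
  exact (withDensityᵥ_continuousLinearMap_comp (ContinuousLinearMap.apply ℝ ℝ p) hui).symm.trans
    (WithDensityᵥEq.congr_ae (hug ⟨p, hp⟩))

theorem exists_withDensityᵥ_eq_of_forall_enorm_le {X : Type*} [NormedAddCommGroup X]
    [NormedSpace ℝ X] [TopologicalSpace.SeparableSpace X] (e : X ≃ₗᵢ[ℝ] StrongDual ℝ P)
    [IsFiniteMeasure m] {μ : VectorMeasure S X} {C : ℝ≥0}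
    (h : ∀ A, MeasurableSet A → ‖μ A‖ₑ ≤ C * m A) :
    ∃ u : S → X, Integrable u m ∧ m.withDensityᵥ u = μ := by
  have : CompleteSpace X := e.toIsometryEquiv.completeSpace
  have : TopologicalSpace.SeparableSpace (StrongDual ℝ P) :=
    e.surjective.denseRange.separableSpace e.continuous
  let L : StrongDual ℝ P →L[ℝ] X := e.symm
  obtain ⟨u, hu, huμ⟩ := exists_withDensityᵥ_eq_of_forall_enorm_le_strongDual
    (μ := imageMeasure (e : X →L[ℝ] StrongDual ℝ P) μ) (m := m) (C := C)
    fun A hA => (e.enorm_map (μ A)).trans_le (h A hA)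
  refine ⟨fun s => L (u s), L.integrable_comp hu, ?_⟩
  rw [withDensityᵥ_continuousLinearMap_comp L hu, huμ]
  ext A -
  exact e.symm_apply_apply (μ A)

end RadonNikodym

section Homogeneous

variable {E : Type*} [AddCommMonoid E] [Module ℝ≥0 E] {F : E → ℝ≥0∞}

theorem convexOn_univ_iff_forall_add_le (hF : ∀ (c : ℝ≥0) (v : E), F (c • v) = c * F v) :
    ConvexOn ℝ≥0 Set.univ F ↔ ∀ v w, F (v + w) ≤ F v + F w := by
  refine ⟨fun hconv v w => ?_, fun hadd => ⟨convex_univ, fun v _ w _ a b _ _ _ => ?_⟩⟩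
  · have hmid := hconv.2 (Set.mem_univ ((2 : ℝ≥0) • v)) (Set.mem_univ ((2 : ℝ≥0) • w))
      zero_le zero_le (by ring : (2⁻¹ : ℝ≥0) + 2⁻¹ = 1)
    have hhalf (x : E) : (2⁻¹ : ℝ≥0) • F ((2 : ℝ≥0) • x) = F x := by
      rw [ENNReal.smul_def, smul_eq_mul, ← hF, inv_smul_smul₀ two_ne_zero]
    rwa [inv_smul_smul₀ two_ne_zero, inv_smul_smul₀ two_ne_zero, hhalf, hhalf] at hmid
  · calc F (a • v + b • w) ≤ F (a • v) + F (b • w) := hadd _ _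
      _ = a • F v + b • F w := by simp only [hF, ENNReal.smul_def, smul_eq_mul]

end Homogeneous

section Density

variable {S X : Type*} [MeasurableSpace S] [NormedAddCommGroup X] [NormedSpace ℝ X]
  {μ ν : radonMeasures S X} {m : Measure S} {f u : S → X}

theorem isDensity_iff_withDensityᵥ_eq :
    IsDensity μ u ↔ Integrable u (totalVar μ) ∧ (totalVar μ).withDensityᵥ u = μ := by
  refine and_congr_right fun hu => ⟨fun h => ?_, fun h A hA => ?_⟩
  · ext A hA
    rw [withDensityᵥ_apply hu hA, h A hA]
  · rw [← withDensityᵥ_apply hu hA, h]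

theorem exists_isDensity_of_predual {P : Type*} [NormedAddCommGroup P] [NormedSpace ℝ P]
    [TopologicalSpace.SeparableSpace X] (e : X ≃ₗᵢ[ℝ] StrongDual ℝ P) (μ : radonMeasures S X) :
    ∃ u, IsDensity μ u := by
  simp only [isDensity_iff_withDensityᵥ_eq]
  refine exists_withDensityᵥ_eq_of_forall_enorm_le e (C := 1) fun A _ => ?_
  rw [ENNReal.coe_one, one_mul]
  exact VectorMeasure.enorm_measure_le_variation _ A

theorem IsDensity.exists_withDensityᵥ_eq [SigmaFinite m] (hu : IsDensity μ u)
    (hm : totalVar μ ≪ m) : ∃ f : S → X, Integrable f m ∧ m.withDensityᵥ f = μ := by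
  obtain ⟨hui, huμ⟩ := isDensity_iff_withDensityᵥ_eq.1 hu
  exact ⟨_, (integrable_rnDeriv_smul_iff hm).2 hui, (withDensityᵥ_rnDeriv_smul hm hui).trans huμ⟩

theorem exists_common_withDensityᵥ_eq (hμ : ∃ u, IsDensity μ u)
    (hν : ∃ u, IsDensity ν u) :
    ∃ (m : Measure S) (f g : S → X), Integrable f m ∧ Integrable g m ∧
      m.withDensityᵥ f = μ ∧ m.withDensityᵥ g = ν := by
  obtain ⟨u, hu⟩ := hμ
  obtain ⟨v, hv⟩ := hν
  obtain ⟨f, hf, hfμ⟩ := hu.exists_withDensityᵥ_eq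
    (Measure.le_add_right le_rfl : totalVar μ ≤ totalVar μ + totalVar ν).absolutelyContinuous
  obtain ⟨g, hg, hgν⟩ := hv.exists_withDensityᵥ_eq
    (Measure.le_add_left le_rfl : totalVar ν ≤ totalVar μ + totalVar ν).absolutelyContinuous
  exact ⟨_, f, g, hf, hg, hfμ, hgν⟩

section Polar

variable [CompleteSpace X]

theorem totalVar_eq_withDensity_enorm (hf : Integrable f m) (hμ : m.withDensityᵥ f = μ) :
    totalVar μ = m.withDensity fun s => ‖f s‖ₑ := by
  rw [totalVar, ← hμ, Measure.variation_withDensityᵥ hf]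

theorem isDensity_inv_norm_smul (hf : Integrable f m) (hμ : m.withDensityᵥ f = μ) :
    IsDensity μ fun s => ‖f s‖⁻¹ • f s := by
  have hsmul : (fun s => ‖f s‖ₑ.toReal • ‖f s‖⁻¹ • f s) = f := by
    ext s
    rcases eq_or_ne (f s) 0 with hs | hs
    · simp [hs]
    · rw [toReal_enorm, smul_inv_smul₀ (norm_ne_zero_iff.2 hs)]
  have hfin : ∀ᵐ s ∂m, ‖f s‖ₑ < ∞ := .of_forall fun s => enorm_lt_top
  rw [isDensity_iff_withDensityᵥ_eq, totalVar_eq_withDensity_enorm hf hμ,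
    integrable_withDensity_iff_integrable_smul₀' hf.1.enorm hfin,
    ← withDensityᵥ_smul_eq_withDensityᵥ_withDensity' hf.1.enorm hfin (by rwa [hsmul]), hsmul]
  exact ⟨hf, hμ⟩

theorem totalVar_univ_eq_lintegral_enorm (hu : IsDensity μ u) :
    totalVar μ Set.univ = ∫⁻ s, ‖u s‖ₑ ∂(totalVar μ) := by
  obtain ⟨hui, huμ⟩ := isDensity_iff_withDensityᵥ_eq.1 hu
  conv_lhs => rw [totalVar_eq_withDensity_enorm hui huμ]
  rw [withDensity_apply _ .univ, setLIntegral_univ]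

end Polar

end Density

theorem ae_eq_zero_or_eq_zero_of_withDensity_mutuallySingular {S : Type*} [MeasurableSpace S]
    {m : Measure S} {F G : S → ℝ≥0∞} (hF : AEMeasurable F m) (hG : AEMeasurable G m)
    (h : m.withDensity F ⟂ₘ m.withDensity G) : ∀ᵐ s ∂m, F s = 0 ∨ G s = 0 := by
  have hFN := (withDensity_apply_eq_zero' hF).1 h.measure_nullSet
  have hGN := (withDensity_apply_eq_zero' hG).1 h.measure_compl_nullSet
  filter_upwards [measure_eq_zero_iff_ae_notMem.1 hFN, measure_eq_zero_iff_ae_notMem.1 hGN]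
    with s hs_F hs_G
  by_contra! hs
  exact (em (s ∈ h.nullSet)).elim (fun hmem => hs_F ⟨hs.1, hmem⟩) fun hmem => hs_G ⟨hs.2, hmem⟩

theorem aemeasurable_integrand {S X : Type*} [MeasurableSpace S] [MeasurableSpace X]
    {J : X → S → ℝ≥0∞} (hJ : Measurable fun p : X × S => J p.1 p.2) {m : Measure S} {f : S → X}
    (hf : AEMeasurable f m) : AEMeasurable (fun s => J (f s) s) m :=
  hJ.comp_aemeasurable (hf.prodMk aemeasurable_id)

section LiftedFunctional

variable {S X : Type*} [MeasurableSpace S] [NormedAddCommGroup X] [NormedSpace ℝ X]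
  [CompleteSpace X] [MeasurableSpace X] [BorelSpace X] {μ ν : radonMeasures S X} {m : Measure S}
  {f : S → X} {J : X → S → ℝ≥0∞}

theorem liftedFunctional_eq_lintegral_of_withDensityᵥ_eq
    (hJ : Measurable fun p : X × S => J p.1 p.2)
    (hhom : ∀ (s : S) (c : ℝ≥0) (v : X), J (c • v) s = c * J v s)
    (hf : Integrable f m) (hμ : m.withDensityᵥ f = μ) :
    liftedFunctional J μ = ∫⁻ s, J (f s) s ∂m := by
  have hu := isDensity_inv_norm_smul hf hμ
  have hmeas := aemeasurable_integrand hJ hu.1.aemeasurable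
  rw [totalVar_eq_withDensity_enorm hf hμ] at hmeas
  rw [liftedFunctional_eq J hu, totalVar_eq_withDensity_enorm hf hμ,
    lintegral_withDensity_eq_lintegral_mul₀' hf.1.enorm hmeas]
  refine lintegral_congr fun s => ?_
  rcases eq_or_ne (f s) 0 with hs | hs
  · simpa [hs] using (hhom s 0 0).symm
  · calc ‖f s‖ₑ * J (‖f s‖⁻¹ • f s) s = J (‖f s‖₊ • ‖f s‖⁻¹ • f s) s := (hhom s _ _).symm
      _ = J (f s) s := by rw [NNReal.smul_def, coe_nnnorm, smul_inv_smul₀ (norm_ne_zero_iff.2 hs)]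

theorem liftedFunctional_add_eq_lintegral {g : S → X}
    (hJ : Measurable fun p : X × S => J p.1 p.2)
    (hhom : ∀ (s : S) (c : ℝ≥0) (v : X), J (c • v) s = c * J v s)
    (hf : Integrable f m) (hg : Integrable g m) (hμ : m.withDensityᵥ f = μ)
    (hν : m.withDensityᵥ g = ν) :
    liftedFunctional J (μ + ν) = ∫⁻ s, J (f s + g s) s ∂m :=
  liftedFunctional_eq_lintegral_of_withDensityᵥ_eq hJ hhom (hf.add hg)
    ((withDensityᵥ_add hf hg).trans (congrArg₂ (· + ·) hμ hν))

theorem liftedFunctional_add_le (hJ : Measurable fun p : X × S => J p.1 p.2)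
    (hhom : ∀ (s : S) (c : ℝ≥0) (v : X), J (c • v) s = c * J v s)
    (hadd : ∀ s v w, J (v + w) s ≤ J v s + J w s)
    (hμ : ∃ u, IsDensity μ u) (hν : ∃ u, IsDensity ν u) :
    liftedFunctional J (μ + ν) ≤ liftedFunctional J μ + liftedFunctional J ν := by
  obtain ⟨m, f, g, hf, hg, hfμ, hgν⟩ := exists_common_withDensityᵥ_eq hμ hν
  rw [liftedFunctional_add_eq_lintegral hJ hhom hf hg hfμ hgν,
    liftedFunctional_eq_lintegral_of_withDensityᵥ_eq hJ hhom hf hfμ,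
    liftedFunctional_eq_lintegral_of_withDensityᵥ_eq hJ hhom hg hgν,
    ← lintegral_add_left' (aemeasurable_integrand hJ hf.aemeasurable)]
  exact lintegral_mono fun s => hadd s _ _

theorem liftedFunctional_add_of_mutuallySingular (hJ : Measurable fun p : X × S => J p.1 p.2)
    (hhom : ∀ (s : S) (c : ℝ≥0) (v : X), J (c • v) s = c * J v s)
    (hμ : ∃ u, IsDensity μ u) (hν : ∃ u, IsDensity ν u) (h : totalVar μ ⟂ₘ totalVar ν) :
    liftedFunctional J (μ + ν) = liftedFunctional J μ + liftedFunctional J ν := by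
  obtain ⟨m, f, g, hf, hg, hfμ, hgν⟩ := exists_common_withDensityᵥ_eq hμ hν
  rw [totalVar_eq_withDensity_enorm hf hfμ, totalVar_eq_withDensity_enorm hg hgν] at h
  rw [liftedFunctional_add_eq_lintegral hJ hhom hf hg hfμ hgν,
    liftedFunctional_eq_lintegral_of_withDensityᵥ_eq hJ hhom hf hfμ,
    liftedFunctional_eq_lintegral_of_withDensityᵥ_eq hJ hhom hg hgν,
    ← lintegral_add_left' (aemeasurable_integrand hJ hf.aemeasurable)]
  refine lintegral_congr_ae ?_
  filter_upwards [ae_eq_zero_or_eq_zero_of_withDensity_mutuallySingular hf.1.enorm hg.1.enorm h]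
    with s hs
  have hJ0 : J 0 s = 0 := by simpa using hhom s 0 0
  rcases hs with hs | hs <;> simp [enorm_eq_zero.1 hs, hJ0]

theorem liftedFunctional_smul (hJ : Measurable fun p : X × S => J p.1 p.2)
    (hhom : ∀ (s : S) (c : ℝ≥0) (v : X), J (c • v) s = c * J v s)
    (hμ : ∃ u, IsDensity μ u) (c : ℝ≥0) :
    liftedFunctional J (c • μ) = c * liftedFunctional J μ := by
  obtain ⟨u, hu⟩ := hμ
  obtain ⟨hui, huμ⟩ := isDensity_iff_withDensityᵥ_eq.1 hu
  have hcμ : (totalVar μ).withDensityᵥ ((c : ℝ) • u) = (c • μ : radonMeasures S X) := by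
    rw [withDensityᵥ_smul, huμ]
    rfl
  rw [liftedFunctional_eq_lintegral_of_withDensityᵥ_eq hJ hhom (hui.smul (c : ℝ)) hcμ,
    liftedFunctional_eq J hu,
    ← lintegral_const_mul'' _ (aemeasurable_integrand hJ hui.aemeasurable)]
  exact lintegral_congr fun s => hhom s c (u s)

theorem ofReal_inv_mul_tvNorm_le_liftedFunctional (hJ : Measurable fun p : X × S => J p.1 p.2)
    (hμ : ∃ u, IsDensity μ u) {C : ℝ} (hC : 0 < C)
    (hcoer : ∀ v s, ENNReal.ofReal ‖v‖ ≤ ENNReal.ofReal C * J v s) :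
    ENNReal.ofReal (C⁻¹ * tvNorm μ) ≤ liftedFunctional J μ := by
  obtain ⟨u, hu⟩ := hμ
  have hvar : totalVar μ Set.univ ≤ ENNReal.ofReal C * liftedFunctional J μ := by
    rw [totalVar_univ_eq_lintegral_enorm hu, liftedFunctional_eq J hu,
      ← lintegral_const_mul'' _ (aemeasurable_integrand hJ hu.1.aemeasurable)]
    refine lintegral_mono fun s => ?_
    rw [← ofReal_norm]
    exact hcoer _ _
  rw [ENNReal.ofReal_mul (inv_nonneg.2 hC.le), ENNReal.ofReal_inv_of_pos hC, tvNorm,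
    ofReal_measureReal, mul_comm, ← div_eq_mul_inv]
  exact ENNReal.div_le_of_le_mul' hvar

end LiftedFunctional

theorem mainTheorem7_general {P X S : Type*} [NormedAddCommGroup P] [NormedSpace ℝ P]
    [NormedAddCommGroup X] [NormedSpace ℝ X] [TopologicalSpace.SeparableSpace X]
    [MeasurableSpace X] [BorelSpace X] (e : X ≃ₗᵢ[ℝ] StrongDual ℝ P) [MeasurableSpace S]
    (J : X → S → ℝ≥0∞) (hJmeas : Measurable fun p : X × S => J p.1 p.2)
    (hJconv : ∀ s, ConvexOn ℝ≥0 Set.univ fun v => J v s)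
    (hJhom : ∀ (s : S) (c : ℝ≥0) (v : X), J (c • v) s = c * J v s)
    (hJcoer : ∃ C : ℝ, 0 < C ∧ ∀ v s, ENNReal.ofReal ‖v‖ ≤ ENNReal.ofReal C * J v s) :
    (∀ μ : radonMeasures S X, ∃ u, IsDensity μ u ∧ ∀ w, IsDensity μ w → w =ᵐ[totalVar μ] u) ∧
    ConvexOn ℝ≥0 Set.univ (liftedFunctional J) ∧
    (∀ (c : ℝ≥0) (μ : radonMeasures S X),
      liftedFunctional J (c • μ) = c * liftedFunctional J μ) ∧
    (∃ C : ℝ, 0 < C ∧ ∀ μ : radonMeasures S X,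
      ENNReal.ofReal (C * tvNorm μ) ≤ liftedFunctional J μ) ∧
    (∀ μ ν : radonMeasures S X, totalVar μ ⟂ₘ totalVar ν →
      liftedFunctional J (μ + ν) = liftedFunctional J μ + liftedFunctional J ν) := by
  have : CompleteSpace X := e.toIsometryEquiv.completeSpace
  have hdens : ∀ μ : radonMeasures S X, ∃ u, IsDensity μ u := exists_isDensity_of_predual e
  have hJadd s := (convexOn_univ_iff_forall_add_le (hJhom s)).1 (hJconv s)
  have hsmul (c : ℝ≥0) (μ : radonMeasures S X) := liftedFunctional_smul hJmeas hJhom (hdens μ) c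
  refine ⟨fun μ => ?_, ?_, hsmul, ?_, fun μ ν =>
    liftedFunctional_add_of_mutuallySingular hJmeas hJhom (hdens μ) (hdens ν)⟩
  · obtain ⟨u, hu⟩ := hdens μ
    exact ⟨u, hu, fun w hw => hw.ae_eq hu⟩
  · exact (convexOn_univ_iff_forall_add_le hsmul).2 fun μ ν =>
      liftedFunctional_add_le hJmeas hJhom hJadd (hdens μ) (hdens ν)
  · obtain ⟨C, hC, hcoer⟩ := hJcoer
    exact ⟨C⁻¹, inv_pos.2 hC, fun μ =>
      ofReal_inv_mul_tvNorm_le_liftedFunctional hJmeas (hdens μ) hC hcoer⟩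

theorem mainTheorem7
    {P X : Type*}
    [NormedAddCommGroup P] [NormedSpace ℝ P] [CompleteSpace P]
    [NormedAddCommGroup X] [NormedSpace ℝ X] [CompleteSpace X]
    [TopologicalSpace.SeparableSpace X] [MeasurableSpace X] [BorelSpace X]
    -- `P` is a predual of `X`
    (e : X ≃ₗᵢ[ℝ] StrongDual ℝ P)
    {d : ℕ} (S : Set (EuclideanSpace ℝ (Fin d))) (hSne : S.Nonempty) (hS : IsCompact S)
    (J : X → S → ℝ≥0∞)
    (hJmeas : Measurable fun p : X × S => J p.1 p.2)
    (hJproper : ∀ s, ∃ v, J v s ≠ ∞)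
    (hJconv : ∀ s, ConvexOn ℝ≥0 Set.univ fun v => J v s)
    (hJhom : ∀ (s : S) (c : ℝ≥0) (v : X), J (c • v) s = c * J v s)
    -- sequential lower semicontinuity for the weak* topology on `X`
    (hJlsc : ∀ (v : ℕ → X) (v₀ : X) (s : ℕ → S) (s₀ : S),
      Tendsto (fun n => StrongDual.toWeakDual (e (v n))) atTop
        (𝓝 (StrongDual.toWeakDual (e v₀))) →
      Tendsto s atTop (𝓝 s₀) →
      J v₀ s₀ ≤ liminf (fun n => J (v n) (s n)) atTop)
    (hJcoer : ∃ C : ℝ, 0 < C ∧ ∀ v s, ENNReal.ofReal ‖v‖ ≤ ENNReal.ofReal C * J v s) :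
    -- every measure has an (a.e. unique) density with respect to its variation
    (∀ μ : radonMeasures S X, ∃ u, IsDensity μ u ∧ ∀ w, IsDensity μ w → w =ᵐ[totalVar μ] u) ∧
    ConvexOn ℝ≥0 Set.univ (liftedFunctional J) ∧
    (∀ (c : ℝ≥0) (μ : radonMeasures S X),
      liftedFunctional J (c • μ) = c * liftedFunctional J μ) ∧
    (∃ C : ℝ, 0 < C ∧ ∀ μ : radonMeasures S X,
      ENNReal.ofReal (C * tvNorm μ) ≤ liftedFunctional J μ) ∧
    (∀ μ ν : radonMeasures S X, totalVar μ ⟂ₘ totalVar ν →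
      liftedFunctional J (μ + ν) = liftedFunctional J μ + liftedFunctional J ν) :=
  mainTheorem7_general e J hJmeas hJconv hJhom hJcoer
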